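/- All graphs are finite and simple, and all graph classes are hereditary (closed under isomorphism and under taking induced subgraphs). A class $\mathcal{A}$ is $\chi$-bounded if there is a non-decreasing $f:\mathbb{N}\to\mathbb{N}$ with $\chi(G)\le f(\omega(G))$ for all $G\in\mathcal{A}$. The graph-intersection of classes $\mathcal{A}$ and $\mathcal{B}$ is the class of all graphs $G_1\cap G_2=(V(G_1)\cap V(G_2),E(G_1)\cap E(G_2))$ with $G_1\in\mathcal{A}$, $G_2\in\mathcal{B}$. The class $\mathcal{A}$ is intersectionwise $\chi$-guarding if its graph-intersection with every $\chi$-bounded class is $\chi$-bounded. A graph $G$ is trivially perfect if in every non-empty induced subgraph of $G$ the independence number equals the number of maximal cliques. A graph is strongly chordal if it has no induced cycle of length at least $4$ and every cycle of even length at least $6$ in it has a chord joining two vertices at odd distance in the cycle. A Burling tree is a tuple $(T,r,l,c)$ in which $T$ is a finite tree with root $r$; $l$ assigns to each non-leaf vertex one of its children, its last-born; and $c$ assigns to each vertex $v$ a set of vertices: if $v$ is the root or a last-born, then $c(v)=\emptyset$, and otherwise $c(v)$ is the vertex set of a (possibly empty) descending path starting at the last-born of the parent of $v$. Let $C(T)$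 be the graph on $V(T)$ in which distinct $u,v$ are adjacent if and only if $v\in c(u)$, or $u\in c(v)$, or $u$ and $v$ lie on a common path from the root to a leaf. The class $\mathcal{C}$ of Burling strongly chordal graphs consists of the graphs isomorphic to an induced subgraph of some $C(T)$. The Burling sequence $(G_k)_{k\ge1}$ is defined together with sets $\mathcal{S}_k$ of subsets of $V(G_k)$. The graph $G_1$ has one vertex, and $\mathcal{S}_1=\{V(G_1)\}$. The graph $G_{k+1}$ is the disjoint union of a copy of $G_k$ and, for each $S\in\mathcal{S}_k$, a further copy $G_k^S$ of $G_k$, together with, for all $S,Q\in\mathcal{S}_k$, a new vertex $v_{S,Q}$ adjacent precisely to the copy $Q^S$ of $Q$ in $G_k^S$. The set $\mathcal{S}_{k+1}$ consists of the sets $S\cup Q^S$ and $S\cup\{v_{S,Q}\}$ for $S,Q\in\mathcal{S}_k$, where $S$ is taken in the first copy of $G_k$. A Burling graph is a graph isomorphic to an induced subgraph of some $G_k$. **Theorem.** The class of trivially perfect graphs is not intersectionwise $\chi$-guarding. Moreover, the class $\mathcal{C}$ is $\chi$-bounded, every graph in $\mathcal{C}$ is strongly chordal, and the graph-intersection of the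 class of trivially perfect graphs with $\mathcal{C}$ contains every Burling graph; every Burling graph is triangle-free, and $\chi(G_k)\ge k$ for every $k\ge1$. -/

import Mathlib

open scoped SimpleGraph

/-- A hereditary class of finite graphs: closed under isomorphism and induced subgraphs
(`H ⊴ G` says that `H` is isomorphic to an induced subgraph of `G`). -/
structure GraphClass where
  Mem : ∀ {V : Type}, SimpleGraph V → Prop
  finite : ∀ {V : Type} {G : SimpleGraph V}, Mem G → Finite V
  hereditary : ∀ {V W : Type} {G : SimpleGraph V} {H : SimpleGraph W}, H ⊴ G → Mem G → Mem H

namespace GraphClass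

/-- `χ(G) ≤ f(ω(G))` on the class, for some non-decreasing `f`. -/
def ChiBounded (A : GraphClass) : Prop :=
  ∃ f : ℕ → ℕ, Monotone f ∧
    ∀ (V : Type) (G : SimpleGraph V), A.Mem G → G.chromaticNumber ≤ (f G.cliqueNum : ℕ∞)

/-- The graph-intersection of two classes: all graphs `G₁ ∩ G₂` with `G₁ ∈ A` and `G₂ ∈ B`, up to
isomorphism, where `V(G₁ ∩ G₂) = V(G₁) ∩ V(G₂)` and `E(G₁ ∩ G₂) = E(G₁) ∩ E(G₂)`.
The two vertex sets need not be equal; `e₁` and `e₂` are the inclusions of the common part. -/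
def inter (A B : GraphClass) : GraphClass where
  Mem {V} G := ∃ (V₁ V₂ : Type) (G₁ : SimpleGraph V₁) (G₂ : SimpleGraph V₂) (e₁ : V ↪ V₁)
    (e₂ : V ↪ V₂), A.Mem G₁ ∧ B.Mem G₂ ∧
      ∀ u v, G.Adj u v ↔ G₁.Adj (e₁ u) (e₁ v) ∧ G₂.Adj (e₂ u) (e₂ v)
  finite := by
    rintro V G ⟨V₁, V₂, G₁, G₂, e₁, e₂, h₁, h₂, h⟩
    have := A.finite h₁
    exact Finite.of_injective e₁ e₁.injective
  hereditary := by
    rintro V W G H ⟨f⟩ ⟨V₁, V₂, G₁, G₂, e₁, e₂, h₁, h₂, h⟩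
    refine ⟨V₁, V₂, G₁, G₂, f.toEmbedding.trans e₁, f.toEmbedding.trans e₂, h₁, h₂, fun u v => ?_⟩
    exact f.map_adj_iff.symm.trans (h (f u) (f v))

/-- The graph-intersection with every χ-bounded class is χ-bounded. -/
def IntersectionwiseChiGuarding (A : GraphClass) : Prop :=
  ∀ B : GraphClass, B.ChiBounded → (A.inter B).ChiBounded

end GraphClass

/-- Trivially perfect graphs: in every induced subgraph with at least one vertex, the independence
number equals the number of maximal cliques. -/
def triviallyPerfect : GraphClass where
  Mem {V} G := Finite V ∧ ∀ (W : Type) (H : SimpleGraph W), Nonempty W → H ⊴ G →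
    H.indepNum = {K : Set W | Maximal H.IsClique K}.ncard
  finite h := h.1
  hereditary := by
    rintro V W G H hHG ⟨hV, h⟩
    refine ⟨?_, fun X K hX hK => h X K hX (hK.trans hHG)⟩
    obtain ⟨f⟩ := hHG
    exact Finite.of_injective f f.injective

/-- No induced cycle of length at least four. -/
def IsChordal {V : Type} (G : SimpleGraph V) : Prop :=
  ∀ n : ℕ, 4 ≤ n → ¬ SimpleGraph.cycleGraph n ⊴ G

/-- A chordal graph in which every (not necessarily induced) cycle of even length at least six has
a chord joining two vertices at odd distance in the cycle. -/
def IsStronglyChordal {V : Type} (G : SimpleGraph V) : Prop :=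
  IsChordal G ∧ ∀ l : ℕ, 3 ≤ l → ∀ c : SimpleGraph.Copy (SimpleGraph.cycleGraph (2 * l)) G,
    ∃ i j : Fin (2 * l), G.Adj (c i) (c j) ∧ ¬ (SimpleGraph.cycleGraph (2 * l)).Adj i j ∧
      i.val % 2 ≠ j.val % 2

/-- A Burling tree `(T, r, l, c)`. In the ancestor order of the rooted tree `T`, the root `r` is
`⊥`, `u ≤ v` says that `u` is an ancestor of `v`, `u ⋖ v` that `v` is a child of `u`, `Order.pred v`
is the parent of `v ≠ ⊥`, the leaves are the maximal elements, and the (non-empty) branches are the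
intervals `Set.Icc a b` with `a ≤ b`. The value of `lastBorn` at a leaf is irrelevant. -/
structure BurlingTree where
  T : RootedTree.{0}
  finite : Finite T
  lastBorn : T → T
  lastBorn_child : ∀ v : T, ¬ IsMax v → v ⋖ lastBorn v
  choose : T → Set T
  choose_branch : ∀ v : T, v ≠ ⊥ → lastBorn (Order.pred v) ≠ v →
    choose v = ∅ ∨
      ∃ b, lastBorn (Order.pred v) ≤ b ∧ choose v = Set.Icc (lastBorn (Order.pred v)) b
  choose_root : choose ⊥ = ∅
  choose_lastBorn : ∀ v : T, ¬ IsMax v → choose (lastBorn v) = ∅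

namespace BurlingTree

/-- `G(T)`: `u` and `v` are adjacent iff `v ∈ c(u)` or `u ∈ c(v)`. -/
def derivedGraph (B : BurlingTree) : SimpleGraph B.T :=
  SimpleGraph.fromRel fun u v => v ∈ B.choose u

/-- `C(T)`: the graph `G(T)` with every principal branch (the vertices on the path from the root
to a leaf) made a clique. -/
def chordalGraph (B : BurlingTree) : SimpleGraph B.T :=
  B.derivedGraph ⊔ SimpleGraph.fromRel fun u v => ∃ b : B.T, IsMax b ∧ u ≤ b ∧ v ≤ b

end BurlingTree

/-- Burling strongly chordal graphs: the induced subgraphs of the graphs `C(T)`. -/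
def burlingStronglyChordal : GraphClass where
  Mem {_} G := ∃ B : BurlingTree, G ⊴ B.chordalGraph
  finite := by
    rintro V G ⟨B, ⟨f⟩⟩
    have := B.finite
    exact Finite.of_injective f f.injective
  hereditary := by
    rintro V W G H hHG ⟨B, hB⟩
    exact ⟨B, hHG.trans hB⟩

/-- A graph with an indexed family of vertex subsets. -/
structure GraphWithSets where
  V : Type
  graph : SimpleGraph V
  I : Type
  sets : I → Set V

namespace GraphWithSets

/-- Vertices of the next graph in the Burling sequence: one copy of `V`, a further copy of `V` for
each `s : I`, and a new vertex `v_{s,q}` for each `s q : I`. -/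
abbrev NextV (X : GraphWithSets) : Type := X.V ⊕ (X.I × X.V) ⊕ (X.I × X.I)

/-- Adjacency of the next graph: the copies of the graph are kept, and `v_{s,q}` is adjacent
precisely to the copy of the set with index `q` in the copy of the graph with index `s`. -/
def nextAdj (X : GraphWithSets) : X.NextV → X.NextV → Prop
  | .inl a, .inl b => X.graph.Adj a b
  | .inr (.inl (s, a)), .inr (.inl (t, b)) => s = t ∧ X.graph.Adj a b
  | .inr (.inr (s, q)), .inr (.inl (t, b)) => s = t ∧ b ∈ X.sets q
  | .inr (.inl (t, b)), .inr (.inr (s, q)) => s = t ∧ b ∈ X.sets q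
  | _, _ => False

/-- One step of Burling's construction. The new sets are, for all `s q : I`, the set `s` in the
first copy together with either the set `q` in the copy with index `s`, or the vertex `v_{s,q}`. -/
def next (X : GraphWithSets) : GraphWithSets where
  V := X.NextV
  graph :=
    { Adj := X.nextAdj
      symm := ⟨by
        rintro (a | ⟨s, a⟩ | ⟨s, q⟩) (b | ⟨t, b⟩ | ⟨t, p⟩) h <;> simp only [nextAdj] at h ⊢
        · exact h.symm
        · exact ⟨h.1.symm, h.2.symm⟩
        · exact h
        · exact h⟩
      loopless := ⟨by rintro (a | ⟨s, a⟩ | ⟨s, q⟩) h <;> simp [nextAdj] at h⟩ }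
  I := (X.I × X.I) ⊕ (X.I × X.I)
  sets
    | .inl (s, q) => Sum.inl '' X.sets s ∪ (fun b => Sum.inr (Sum.inl (s, b))) '' X.sets q
    | .inr (s, q) => Sum.inl '' X.sets s ∪ {Sum.inr (Sum.inr (s, q))}

end GraphWithSets

/-- Burling's construction: it starts from the one-vertex graph with its vertex set as the only
distinguished set. -/
def burlingSystem : ℕ → GraphWithSets
  | 0 => ⟨Unit, ⊥, Unit, fun _ => Set.univ⟩
  | n + 1 => (burlingSystem n).next

theorem burlingSystem_finite (n : ℕ) : Finite (burlingSystem n).V ∧ Finite (burlingSystem n).I := by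
  induction n with
  | zero => exact ⟨inferInstanceAs (Finite Unit), inferInstanceAs (Finite Unit)⟩
  | succ n ih =>
    obtain ⟨h₁, h₂⟩ := ih
    exact ⟨inferInstanceAs (Finite (burlingSystem n).NextV),
      inferInstanceAs (Finite (((burlingSystem n).I × (burlingSystem n).I) ⊕
        ((burlingSystem n).I × (burlingSystem n).I)))⟩

/-- The Burling sequence, indexed from zero: `burlingGraph n` is the graph usually called
`G_{n+1}`. -/
def burlingGraph (n : ℕ) : SimpleGraph (burlingSystem n).V := (burlingSystem n).graph

/-- Burling graphs: the induced subgraphs of the graphs in the Burling sequence. -/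
def burlingGraphs : GraphClass where
  Mem {_} G := ∃ n : ℕ, G ⊴ burlingGraph n
  finite := by
    rintro V G ⟨n, ⟨f⟩⟩
    have := (burlingSystem_finite n).1
    exact Finite.of_injective f f.injective
  hereditary := by
    rintro V W G H hHG ⟨n, hn⟩
    exact ⟨n, hHG.trans hn⟩

/-!
In `C(T)` the closed neighbourhoods shrink along each branch. Take the last vertex, in the
depth-first order that visits last-born subtrees first, of a set of vertices: its neighbours in the
set are its ancestors and vertices of the branch it chooses, hence lie on one branch and have nested
closed neighbourhoods. Such simple vertices yield strong chordality (Farber) and a greedy colouring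
with `ω` colours.

A vertex can choose only descendants of its last-born sibling. This relation, completed by a linear
order on the siblings that are not last-born, is a forest order. Its comparability graph is
trivially perfect and meets `C(T)` exactly in `G(T)`.

If the branches of the leaves of `T` cut out `𝒮_k` on a copy of `G_k` in `G(T)`, then attach below
each leaf `S` a copy of `T` as last-born subtree, and leaves `v_{S,Q}` choosing the branch of `Q` in
that copy. The branches of the leaves of the new tree cut out `𝒮_{k+1}` on a copy of `G_{k+1}`.

Every colouring of `G_k` has `k` colours on some `S ∈ 𝒮_k`: given such an `S`, and such a `Q` in the
copy attached to `S`, the colour of `v_{S,Q}` is not one of those on `Q^S`. If it occurs on `S`,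
then `S ∪ Q^S` has `k + 1` colours, and otherwise `S ∪ {v_{S,Q}}` has.
-/

section SimpleVertices

variable {V W : Type*}

/-- The closed neighbourhood `N[v]`. -/
def closedNeighborSet (G : SimpleGraph V) (v : V) : Set V :=
  insert v (G.neighborSet v)

theorem mem_closedNeighborSet {G : SimpleGraph V} {v w : V} :
    w ∈ closedNeighborSet G v ↔ w = v ∨ G.Adj v w :=
  Iff.rfl

theorem self_mem_closedNeighborSet (G : SimpleGraph V) (v : V) : v ∈ closedNeighborSet G v :=
  Set.mem_insert v _

/-- The vertex `v` is simple, in the sense of Farber, in the subgraph induced by `insert v S`: the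
closed neighbourhoods of its neighbours are linearly ordered by inclusion. -/
def IsSimpleIn (G : SimpleGraph V) (S : Set V) (v : V) : Prop :=
  IsChain (fun x y => closedNeighborSet G x ∩ S ⊆ closedNeighborSet G y) (S ∩ G.neighborSet v)

/-- Every non-empty induced subgraph has a simple vertex. By a theorem of Farber this
characterizes strongly chordal graphs among the finite graphs. -/
def HasSimpleVertices (G : SimpleGraph V) : Prop :=
  ∀ S : Set V, S.Nonempty → ∃ v ∈ S, IsSimpleIn G S v

variable {G : SimpleGraph V} {H : SimpleGraph W}

theorem IsSimpleIn.isClique_inter_neighborSet {S : Set V} {v : V} (hv : IsSimpleIn G S v) :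
    G.IsClique (S ∩ G.neighborSet v) := by
  intro x hx y hy hxy
  rcases hv hx hy hxy with h | h
  · exact ((h ⟨self_mem_closedNeighborSet G x, hx.1⟩).resolve_left hxy).symm
  · exact (h ⟨self_mem_closedNeighborSet G y, hy.1⟩).resolve_left hxy.symm

theorem HasSimpleVertices.of_isIndContained (hG : HasSimpleVertices G) (h : H ⊴ G) :
    HasSimpleVertices H := by
  obtain ⟨f⟩ := h
  intro S hS
  obtain ⟨_, ⟨v, hv, rfl⟩, hsimple⟩ := hG (f '' S) (hS.image f)
  refine ⟨v, hv, fun x ⟨hx, hvx⟩ y ⟨hy, hvy⟩ hxy => ?_⟩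
  have := hsimple ⟨⟨x, hx, rfl⟩, f.map_adj_iff.2 hvx⟩ ⟨⟨y, hy, rfl⟩, f.map_adj_iff.2 hvy⟩
    (f.injective.ne hxy)
  refine this.imp (fun h z hz => ?_) (fun h z hz => ?_) <;>
  · have := @h (f z) ⟨by simpa [mem_closedNeighborSet] using hz.1, ⟨z, hz.2, rfl⟩⟩
    simpa [mem_closedNeighborSet] using this

theorem colorable_of_exists_ncard_lt [Finite V] {k : ℕ}
    (h : ∀ S : Set V, S.Nonempty → ∃ v ∈ S, (S ∩ G.neighborSet v).ncard < k) :
    G.Colorable k := by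
  classical
  obtain _ | hV := isEmpty_or_nonempty V
  · exact .of_isEmpty k
  have : Nonempty (Fin k) := by
    obtain ⟨v, -, hv⟩ := h Set.univ Set.univ_nonempty
    exact ⟨⟨_, hv⟩⟩
  suffices hS : ∀ S : Set V, ∃ f : V → Fin k, S.Pairwise fun x y => G.Adj x y → f x ≠ f y by
    obtain ⟨f, hf⟩ := hS Set.univ
    exact ⟨.mk f fun hxy => hf trivial trivial hxy.ne hxy⟩
  intro S
  induction S using WellFoundedLT.induction with
  | ind S ih =>
    obtain rfl | hne := S.eq_empty_or_nonempty
    · exact ⟨Classical.arbitrary _, Set.pairwise_empty _⟩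
    obtain ⟨v, hv, hcard⟩ := h S hne
    obtain ⟨f, hf⟩ := ih (S \ {v}) (Set.sdiff_singleton_ssubset.2 hv)
    obtain ⟨c, hc⟩ : ∃ c, c ∉ f '' (S ∩ G.neighborSet v) := by
      by_contra! hall
      have hle := (Set.ncard_image_le (f := f) (Set.toFinite (S ∩ G.neighborSet v))).trans_lt hcard
      simp [Set.eq_univ_of_forall hall] at hle
    have hc' : ∀ x ∈ S, G.Adj v x → f x ≠ c := fun x hx hvx hxc => hc ⟨x, ⟨hx, hvx⟩, hxc⟩
    refine ⟨Function.update f v c, fun x hx y hy hxy hadj => ?_⟩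
    obtain rfl | hxv := eq_or_ne x v
    · simpa [hxy.symm] using (hc' y hy hadj).symm
    obtain rfl | hyv := eq_or_ne y v
    · simpa [hxv] using hc' x hx hadj.symm
    · simpa [hxv, hyv] using hf ⟨hx, hxv⟩ ⟨hy, hyv⟩ hxy hadj

theorem HasSimpleVertices.colorable_cliqueNum [Finite V] (hG : HasSimpleVertices G) :
    G.Colorable G.cliqueNum := by
  classical
  have := Fintype.ofFinite V
  refine colorable_of_exists_ncard_lt fun S hS => ?_
  obtain ⟨v, hv, hsimple⟩ := hG S hS
  refine ⟨v, hv, ?_⟩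
  set N := S ∩ G.neighborSet v
  have hclique : G.IsClique (insert v N) :=
    hsimple.isClique_inter_neighborSet.insert fun x hx _ => hx.2
  have hcard : (insert v N).ncard ≤ G.cliqueNum := by
    rw [Set.ncard_eq_toFinset_card']
    exact SimpleGraph.IsClique.card_le_cliqueNum (tc := by simpa using hclique)
  rwa [Set.ncard_insert_of_notMem (fun h => G.loopless.irrefl v h.2)] at hcard

end SimpleVertices

section Cycles

theorem cycleGraph_adj_iff_val {n : ℕ} (hn : 3 ≤ n) {i j : Fin n} :
    (SimpleGraph.cycleGraph n).Adj i j ↔ i.val + 1 = j.val ∨ j.val + 1 = i.val ∨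
      (i.val = 0 ∧ j.val + 1 = n) ∨ (j.val = 0 ∧ i.val + 1 = n) := by
  rw [SimpleGraph.cycleGraph_adj']
  rcases lt_trichotomy i j with h | rfl | h
  · rw [Fin.coe_sub_iff_lt.2 h, Fin.coe_sub_iff_le.2 h.le]
    omega
  · rw [Fin.coe_sub_iff_le.2 le_rfl]
    omega
  · rw [Fin.coe_sub_iff_lt.2 h, Fin.coe_sub_iff_le.2 h.le]
    omega

theorem exists_fin_val_add_eq {n k : ℕ} (i : Fin n) (hk : k < n) :
    ∃ j : Fin n, i.val + k = j.val ∨ i.val + k = j.val + n := by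
  obtain h | h := lt_or_ge (i.val + k) n
  · exact ⟨⟨i.val + k, h⟩, Or.inl rfl⟩
  · exact ⟨⟨i.val + k - n, by omega⟩, Or.inr (Nat.sub_add_cancel h).symm⟩

theorem exists_cycleGraph_adj_adj_not_adj {n : ℕ} (hn : 4 ≤ n) (i : Fin n) :
    ∃ b c : Fin n, (SimpleGraph.cycleGraph n).Adj i b ∧ (SimpleGraph.cycleGraph n).Adj i c ∧
      b ≠ c ∧ ¬ (SimpleGraph.cycleGraph n).Adj b c := by
  obtain ⟨b, hb⟩ := exists_fin_val_add_eq i (show n - 1 < n by omega)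
  obtain ⟨c, hc⟩ := exists_fin_val_add_eq i (show 1 < n by omega)
  refine ⟨b, c, ?_⟩
  simp only [cycleGraph_adj_iff_val (show 3 ≤ n by omega), ne_eq, Fin.ext_iff]
  omega

/-- `a b i c d` are consecutive vertices of the cycle. -/
theorem exists_cycleGraph_centered_path {l : ℕ} (hl : 3 ≤ l) (i : Fin (2 * l)) :
    ∃ a b c d : Fin (2 * l),
      (SimpleGraph.cycleGraph (2 * l)).Adj i b ∧ (SimpleGraph.cycleGraph (2 * l)).Adj i c ∧
      (SimpleGraph.cycleGraph (2 * l)).Adj b a ∧ (SimpleGraph.cycleGraph (2 * l)).Adj c d ∧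
      (¬ (SimpleGraph.cycleGraph (2 * l)).Adj b d ∧ b.val % 2 ≠ d.val % 2) ∧
      (¬ (SimpleGraph.cycleGraph (2 * l)).Adj c a ∧ c.val % 2 ≠ a.val % 2) := by
  obtain ⟨a, ha⟩ := exists_fin_val_add_eq i (show 2 * l - 2 < 2 * l by omega)
  obtain ⟨b, hb⟩ := exists_fin_val_add_eq i (show 2 * l - 1 < 2 * l by omega)
  obtain ⟨c, hc⟩ := exists_fin_val_add_eq i (show 1 < 2 * l by omega)
  obtain ⟨d, hd⟩ := exists_fin_val_add_eq i (show 2 < 2 * l by omega)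
  refine ⟨a, b, c, d, ?_⟩
  simp only [cycleGraph_adj_iff_val (show 3 ≤ 2 * l by omega)]
  omega

variable {V : Type} {G : SimpleGraph V}

theorem HasSimpleVertices.isChordal (hG : HasSimpleVertices G) : IsChordal G := by
  intro n hn h
  obtain ⟨i, -, hi⟩ := hG.of_isIndContained h Set.univ ⟨⟨0, by omega⟩, trivial⟩
  obtain ⟨b, c, hib, hic, hbc, hnadj⟩ := exists_cycleGraph_adj_adj_not_adj hn i
  exact hnadj (hi.isClique_inter_neighborSet ⟨trivial, hib⟩ ⟨trivial, hic⟩ hbc)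

theorem HasSimpleVertices.isStronglyChordal (hG : HasSimpleVertices G) :
    IsStronglyChordal G := by
  refine ⟨hG.isChordal, fun l hl f => ?_⟩
  obtain ⟨_, ⟨i, rfl⟩, hi⟩ := hG (Set.range f) ⟨f ⟨0, by omega⟩, Set.mem_range_self _⟩
  obtain ⟨a, b, c, d, hib, hic, hba, hcd, ⟨hbd, hbd'⟩, hca, hca'⟩ :=
    exists_cycleGraph_centered_path hl i
  have chord {x y z : Fin (2 * l)} (hxz : (SimpleGraph.cycleGraph (2 * l)).Adj x z)
      (hyz : y.val % 2 ≠ z.val % 2)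
      (h : closedNeighborSet G (f x) ∩ Set.range f ⊆ closedNeighborSet G (f y)) :
      G.Adj (f y) (f z) :=
    (h ⟨Or.inr (f.toHom.map_adj hxz), z, rfl⟩).resolve_left
      fun he => hyz (congrArg (·.val % 2) (f.injective he).symm)
  have hbc : f b ≠ f c := f.injective.ne (by rintro rfl; exact hbd hcd)
  rcases hi ⟨⟨b, rfl⟩, f.toHom.map_adj hib⟩ ⟨⟨c, rfl⟩, f.toHom.map_adj hic⟩ hbc with h | h
  · exact ⟨c, a, chord hba hca' h, hca, hca'⟩
  · exact ⟨b, d, chord hcd hbd' h, hbd, hbd'⟩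

end Cycles

theorem lt_iff_le_of_covBy {α : Type*} [PartialOrder α] [PredOrder α] {p u x : α} (h : p ⋖ u) :
    x < u ↔ x ≤ p :=
  ⟨fun hx => h.pred_eq ▸ Order.le_pred_of_lt hx, fun hx => hx.trans_lt h.lt⟩

theorem exists_isMax_ge {α : Type*} [Preorder α] [Finite α] (a : α) : ∃ m, IsMax m ∧ a ≤ m :=
  let ⟨m, ham, hm⟩ := Finite.exists_le_maximal (p := fun _ => True) (a := a) trivial
  ⟨m, maximal_true.1 hm, ham⟩

namespace BurlingTree

variable {B : BurlingTree} {l u v w x y z : B.T}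

theorem le_total_of_le (hx : x ≤ v) (hy : y ≤ v) : x ≤ y ∨ y ≤ x :=
  (le_total_of_directed hx hy).symm

section LastBornSibling

variable (B) in
/-- `u` is a child other than the last-born one, and `l` is the last-born child of its parent. -/
def LastBornSibling (u l : B.T) : Prop :=
  l ≠ u ∧ ∃ p, p ⋖ u ∧ B.lastBorn p = l

theorem LastBornSibling.unique {l' : B.T} (h : B.LastBornSibling u l)
    (h' : B.LastBornSibling u l') : l = l' := by
  obtain ⟨-, p, hp, rfl⟩ := h
  obtain ⟨-, p', hp', rfl⟩ := h'
  rw [← hp.pred_eq, hp'.pred_eq]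

theorem LastBornSibling.lt_iff (h : B.LastBornSibling u l) : x < u ↔ x < l := by
  obtain ⟨-, p, hp, rfl⟩ := h
  rw [lt_iff_le_of_covBy hp, lt_iff_le_of_covBy (B.lastBorn_child p hp.lt.not_isMax)]

theorem LastBornSibling.not_le_of_le (h : B.LastBornSibling u l) (hl : l ≤ v) : ¬ u ≤ v := by
  intro hu
  rcases le_total_of_le hu hl with hle | hle
  · exact lt_irrefl u (h.lt_iff.2 (hle.lt_of_ne h.1.symm))
  · exact lt_irrefl l (h.lt_iff.1 (hle.lt_of_ne h.1))

theorem LastBornSibling.lt_of_le {m : B.T} (hu : B.LastBornSibling u l)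
    (hv : B.LastBornSibling v m) (h : l ≤ v) : l < m := by
  refine hv.lt_iff.1 (h.lt_of_ne ?_)
  rintro rfl
  obtain ⟨-, p, hp, rfl⟩ := hu
  obtain ⟨hne, q, hq, rfl⟩ := hv
  obtain rfl : q = p := by rw [← hq.pred_eq, (B.lastBorn_child p hp.lt.not_isMax).pred_eq]
  exact hne rfl

end LastBornSibling

theorem choose_eq_empty_or_Icc (v : B.T) :
    B.choose v = ∅ ∨ ∃ l b, B.LastBornSibling v l ∧ l ≤ b ∧ B.choose v = Set.Icc l b := by
  obtain rfl | hv := eq_or_ne v ⊥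
  · exact Or.inl B.choose_root
  have hp : Order.pred v ⋖ v := Order.pred_covBy_of_not_isMin (by simpa using hv)
  obtain h | h := eq_or_ne (B.lastBorn (Order.pred v)) v
  · exact Or.inl (h ▸ B.choose_lastBorn _ hp.lt.not_isMax)
  · exact (B.choose_branch v hv h).imp_right fun ⟨b, hb⟩ => ⟨_, b, ⟨h, _, hp, rfl⟩, hb⟩

section CanChoose

variable (B) in
/-- The vertices that `u` may choose: the descendants of the last-born sibling of `u`. -/
def CanChoose (u v : B.T) : Prop :=
  ∃ l, B.LastBornSibling u l ∧ l ≤ v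

theorem canChoose_of_mem_choose (h : v ∈ B.choose u) : B.CanChoose u v := by
  obtain he | ⟨l, b, hl, -, he⟩ := B.choose_eq_empty_or_Icc u
  · simp [he] at h
  · exact ⟨l, hl, (he ▸ h).1⟩

theorem CanChoose.not_le (h : B.CanChoose u v) : ¬ u ≤ v :=
  let ⟨_, hl, hlv⟩ := h
  hl.not_le_of_le hlv

theorem CanChoose.not_ge (h : B.CanChoose u v) : ¬ v ≤ u :=
  let ⟨_, hl, hlv⟩ := h
  fun hvu => hl.not_le_of_le (hlv.trans hvu) le_rfl

theorem CanChoose.lt_of_lt (h : B.CanChoose u v) (hx : x < u) : x < v :=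
  let ⟨_, hl, hlv⟩ := h
  (hl.lt_iff.1 hx).trans_le hlv

theorem CanChoose.lt_or_canChoose_of_le (h : B.CanChoose u v) (hx : x ≤ v) :
    x < u ∨ B.CanChoose u x := by
  obtain ⟨l, hl, hlv⟩ := h
  by_cases hlx : l ≤ x
  · exact Or.inr ⟨l, hl, hlx⟩
  · exact Or.inl (hl.lt_iff.2 (((le_total_of_le hx hlv).resolve_right hlx).lt_of_not_ge hlx))

theorem CanChoose.trans (huv : B.CanChoose u v) (hvw : B.CanChoose v w) : B.CanChoose u w := by
  obtain ⟨l, hl, hlv⟩ := huv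
  obtain ⟨m, hm, hmw⟩ := hvw
  exact ⟨l, hl, (hl.lt_of_le hm hlv).le.trans hmw⟩

theorem le_total_of_mem_choose (hx : x ∈ B.choose v) (hy : y ∈ B.choose v) : x ≤ y ∨ y ≤ x := by
  obtain he | ⟨l, b, -, -, he⟩ := B.choose_eq_empty_or_Icc v
  · simp [he] at hx
  · rw [he] at hx hy
    exact le_total_of_le hx.2 hy.2

theorem mem_choose_of_le (hy : y ∈ B.choose v) (hx : B.CanChoose v x) (hxy : x ≤ y) :
    x ∈ B.choose v := by
  obtain ⟨l, hl, hlx⟩ := hx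
  obtain he | ⟨l', b, hl', -, he⟩ := B.choose_eq_empty_or_Icc v
  · simp [he] at hy
  · obtain rfl := hl.unique hl'
    rw [he] at hy ⊢
    exact ⟨hlx, hxy.trans hy.2⟩

end CanChoose

section ChordalGraph

theorem derivedGraph_adj : B.derivedGraph.Adj u v ↔ v ∈ B.choose u ∨ u ∈ B.choose v := by
  rw [derivedGraph, SimpleGraph.fromRel_adj, and_iff_right_iff_imp]
  rintro h rfl
  exact (canChoose_of_mem_choose (or_self_iff.1 h)).not_le le_rfl

theorem not_le_of_derivedGraph_adj (h : B.derivedGraph.Adj u v) : ¬ u ≤ v :=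
  (derivedGraph_adj.1 h).elim (fun h => (canChoose_of_mem_choose h).not_le)
    fun h => (canChoose_of_mem_choose h).not_ge

theorem exists_isMax_and_le_iff : (∃ b : B.T, IsMax b ∧ u ≤ b ∧ v ≤ b) ↔ u ≤ v ∨ v ≤ u := by
  have := B.finite
  constructor
  · rintro ⟨b, -, hu, hv⟩
    exact le_total_of_le hu hv
  · rintro (h | h)
    · obtain ⟨b, hb, hle⟩ := exists_isMax_ge v
      exact ⟨b, hb, h.trans hle, hle⟩
    · obtain ⟨b, hb, hle⟩ := exists_isMax_ge u
      exact ⟨b, hb, hle, h.trans hle⟩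

theorem chordalGraph_adj :
    B.chordalGraph.Adj u v ↔ B.derivedGraph.Adj u v ∨ u < v ∨ v < u := by
  rw [chordalGraph, SimpleGraph.sup_adj, SimpleGraph.fromRel_adj, exists_isMax_and_le_iff,
    exists_isMax_and_le_iff, lt_iff_le_and_ne, lt_iff_le_and_ne, ne_comm (a := v)]
  tauto

theorem mem_closedNeighborSet_chordalGraph : v ∈ closedNeighborSet B.chordalGraph u ↔
    B.derivedGraph.Adj u v ∨ u ≤ v ∨ v ≤ u := by
  rw [mem_closedNeighborSet, chordalGraph_adj, le_iff_lt_or_eq, le_iff_lt_or_eq, eq_comm (a := v)]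
  tauto

theorem closedNeighborSet_chordalGraph_antitone :
    Antitone (closedNeighborSet B.chordalGraph) := by
  intro x y hxy z hz
  rw [mem_closedNeighborSet_chordalGraph] at hz ⊢
  rcases hz with hyz | hyz | hzy
  · rcases derivedGraph_adj.1 hyz with h | h
    · obtain rfl | hlt := hxy.eq_or_lt
      · exact Or.inl hyz
      · exact Or.inr (Or.inl ((canChoose_of_mem_choose h).lt_of_lt hlt).le)
    · rcases (canChoose_of_mem_choose h).lt_or_canChoose_of_le hxy with hxz | hzx
      · exact Or.inr (Or.inl hxz.le)
      · exact Or.inl (derivedGraph_adj.2 (Or.inr (mem_choose_of_le h hzx hxy)))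
  · exact Or.inr (Or.inl (hxy.trans hyz))
  · exact Or.inr (le_total_of_le hxy hzy)

end ChordalGraph

section DepthFirst

variable (B) in
/-- `v` comes before `u` in the depth-first order that visits the subtree of a last-born child
before its siblings. -/
def Before (v u : B.T) : Prop :=
  v < u ∨ ∃ u' ≤ u, B.CanChoose u' v

theorem Before.trans (hwv : B.Before w v) (hvu : B.Before v u) : B.Before w u := by
  rcases hvu with hvu | ⟨u', hu', hu'v⟩
  · exact hwv.imp hvu.trans' fun ⟨v', hv', h⟩ => ⟨v', hv'.trans hvu.le, h⟩
  rcases hwv with hwv | ⟨v', hv', hv'w⟩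
  · exact (hu'v.lt_or_canChoose_of_le hwv.le).imp (·.trans_le hu') fun h => ⟨u', hu', h⟩
  · rcases hu'v.lt_or_canChoose_of_le hv' with h | h
    · exact Or.inr ⟨v', h.le.trans hu', hv'w⟩
    · exact Or.inr ⟨u', hu', h.trans hv'w⟩

theorem Before.irrefl (u : B.T) : ¬ B.Before u u := by
  rintro (h | ⟨u', hu', h⟩)
  · exact lt_irrefl u h
  · exact h.not_le hu'

theorem exists_forall_not_before {S : Set B.T} (hS : S.Nonempty) :
    ∃ v ∈ S, ∀ w ∈ S, ¬ B.Before v w := by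
  have := B.finite
  have : IsTrans B.T (Function.swap B.Before) := ⟨fun _ _ _ h₁ h₂ => h₂.trans h₁⟩
  have : Std.Irrefl (Function.swap B.Before) := ⟨Before.irrefl⟩
  exact (Finite.wellFounded_of_trans_of_irrefl (Function.swap B.Before)).has_min S hS

theorem mem_choose_of_adj_of_not_before (hvw : B.derivedGraph.Adj v w) (h : ¬ B.Before v w) :
    w ∈ B.choose v :=
  (derivedGraph_adj.1 hvw).resolve_right fun hv =>
    h (Or.inr ⟨w, le_rfl, canChoose_of_mem_choose hv⟩)

theorem hasSimpleVertices_chordalGraph : HasSimpleVertices B.chordalGraph := by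
  intro S hS
  obtain ⟨v, hv, hlast⟩ := exists_forall_not_before hS
  have hnbr : ∀ w ∈ S ∩ B.chordalGraph.neighborSet v, w ∈ B.choose v ∨ w < v := by
    rintro w ⟨hw, hvw⟩
    rcases chordalGraph_adj.1 hvw with h | h | h
    · exact Or.inl (mem_choose_of_adj_of_not_before h (hlast w hw))
    · exact (hlast w hw (Or.inl h)).elim
    · exact Or.inr h
  have hchain : IsChain (· ≤ ·) (S ∩ B.chordalGraph.neighborSet v) := by
    intro x hx y hy _
    rcases hnbr x hx with hx | hx <;> rcases hnbr y hy with hy | hy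
    · exact le_total_of_mem_choose hx hy
    · exact Or.inr ((canChoose_of_mem_choose hx).lt_of_lt hy).le
    · exact Or.inl ((canChoose_of_mem_choose hy).lt_of_lt hx).le
    · exact le_total_of_le hx.le hy.le
  refine ⟨v, hv, fun x hx y hy hxy => (hchain hx hy hxy).symm.imp ?_ ?_⟩ <;>
  · exact fun h => Set.inter_subset_left.trans (closedNeighborSet_chordalGraph_antitone h)

theorem derivedGraph_cliqueFree : B.derivedGraph.CliqueFree 3 := by
  classical
  intro S hS
  obtain ⟨v, hv, hlast⟩ := exists_forall_not_before (S := (S : Set B.T))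
    (Finset.card_pos.1 (by simp [hS.card_eq]))
  have hnbr : ∀ w ∈ S.erase v, w ∈ B.choose v := fun w hw =>
    mem_choose_of_adj_of_not_before
      (hS.isClique hv (Finset.mem_of_mem_erase hw) (Finset.ne_of_mem_erase hw).symm)
      (hlast w (Finset.mem_of_mem_erase hw))
  obtain ⟨x, hx, y, hy, hxy⟩ := Finset.one_lt_card.1
    (show 1 < (S.erase v).card by simp [Finset.card_erase_of_mem hv, hS.card_eq])
  have hadj : B.derivedGraph.Adj x y :=
    hS.isClique (Finset.mem_of_mem_erase hx) (Finset.mem_of_mem_erase hy) hxy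
  exact (le_total_of_mem_choose (hnbr x hx) (hnbr y hy)).elim
    (not_le_of_derivedGraph_adj hadj) (not_le_of_derivedGraph_adj hadj.symm)

end DepthFirst

end BurlingTree

theorem hasSimpleVertices_of_mem_burlingStronglyChordal {V : Type} {G : SimpleGraph V}
    (hG : burlingStronglyChordal.Mem G) : HasSimpleVertices G :=
  let ⟨_, hB⟩ := hG
  BurlingTree.hasSimpleVertices_chordalGraph.of_isIndContained hB

theorem burlingStronglyChordal_chiBounded : burlingStronglyChordal.ChiBounded := by
  refine ⟨id, monotone_id, fun V G hG => ?_⟩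
  have := burlingStronglyChordal.finite hG
  exact (hasSimpleVertices_of_mem_burlingStronglyChordal hG).colorable_cliqueNum.chromaticNumber_le

section ComparabilityGraph

variable {V : Type*}

theorem exists_isGreatest_of_isChain [Preorder V] {s : Set V} (hfin : s.Finite) (hs : s.Nonempty)
    (hchain : IsChain (· ≤ ·) s) : ∃ m, IsGreatest s m := by
  obtain ⟨m, hm⟩ := hfin.exists_maximal hs
  exact ⟨m, hm.prop, fun a ha => (hchain.total ha hm.prop).elim id (hm.le_of_ge ha)⟩

variable [PartialOrder V]

theorem maximal_isChain_iff_exists_isMax [Finite V] [Nonempty V]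
    (hforest : ∀ a : V, IsChain (· ≤ ·) (Set.Iic a)) {K : Set V} :
    Maximal (IsChain (· ≤ ·)) K ↔ ∃ m, IsMax m ∧ Set.Iic m = K := by
  constructor
  · intro hK
    have hne : K.Nonempty := by
      by_contra! rfl
      exact hK.not_prop_of_gt (Set.nonempty_Iic.empty_ssubset) (hforest (Classical.arbitrary V))
    obtain ⟨k, -, hk⟩ := exists_isGreatest_of_isChain K.toFinite hne hK.prop
    obtain ⟨m, hm, hkm⟩ := exists_isMax_ge k
    exact ⟨m, hm, (hK.eq_of_ge (hforest m) fun x hx => (hk hx).trans hkm)⟩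
  · rintro ⟨m, hm, rfl⟩
    refine ⟨hforest m, fun K hK hle x hx => ?_⟩
    exact (hK.total hx (hle Set.self_mem_Iic)).elim id (hm ·)

theorem ncard_le_ncard_setOf_isMax_of_isAntichain [Finite V]
    (hforest : ∀ a : V, IsChain (· ≤ ·) (Set.Iic a)) {A : Set V} (hA : IsAntichain (· ≤ ·) A) :
    A.ncard ≤ {m : V | IsMax m}.ncard := by
  choose f hf hle using exists_isMax_ge (α := V)
  refine Set.ncard_le_ncard_of_injOn f (fun a _ => hf a) fun a ha b hb hab => ?_
  rcases (hforest (f b)).total (hab ▸ hle a : a ≤ f b) (hle b) with h | h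
  · exact hA.eq ha hb h
  · exact (hA.eq hb ha h).symm

variable (V) in
/-- The graph in which two elements of a partial order are adjacent if they are comparable. -/
def comparabilityGraph : SimpleGraph V :=
  SimpleGraph.fromRel (· < ·)

theorem comparabilityGraph_adj {a b : V} : (comparabilityGraph V).Adj a b ↔ a < b ∨ b < a :=
  and_iff_right_of_imp fun h => h.elim ne_of_lt ne_of_gt

theorem isClique_comparabilityGraph_iff_isChain {s : Set V} :
    (comparabilityGraph V).IsClique s ↔ IsChain (· ≤ ·) s := by
  refine forall₂_congr fun a _ => forall₂_congr fun b _ => forall_congr' fun hab => ?_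
  exact comparabilityGraph_adj.trans (or_congr hab.le_iff_lt hab.symm.le_iff_lt).symm

theorem isIndepSet_comparabilityGraph_iff_isAntichain {s : Set V} :
    (comparabilityGraph V).IsIndepSet s ↔ IsAntichain (· ≤ ·) s := by
  constructor
  · exact fun hs a ha b hb hab hle =>
      hs ha hb hab (comparabilityGraph_adj.2 (Or.inl (hle.lt_of_ne hab)))
  · exact fun hs a ha b hb hab hadj => (comparabilityGraph_adj.1 hadj).elim
      (fun h => hs ha hb hab h.le) fun h => hs hb ha hab.symm h.le

theorem indepNum_comparabilityGraph [Finite V]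
    (hforest : ∀ a : V, IsChain (· ≤ ·) (Set.Iic a)) :
    (comparabilityGraph V).indepNum = {m : V | IsMax m}.ncard := by
  classical
  have := Fintype.ofFinite V
  apply le_antisymm
  · obtain ⟨A, hA, hcard⟩ := (comparabilityGraph V).exists_isNIndepSet_indepNum
    rw [← hcard, ← Set.ncard_coe_finset]
    exact ncard_le_ncard_setOf_isMax_of_isAntichain hforest
      (isIndepSet_comparabilityGraph_iff_isAntichain.1 hA)
  · rw [Set.ncard_eq_toFinset_card']
    refine SimpleGraph.IsIndepSet.card_le_indepNum
      (isIndepSet_comparabilityGraph_iff_isAntichain.2 ?_)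
    rw [Set.coe_toFinset]
    exact fun a ha b _ hne hab => hne (ha.eq_of_le hab)

theorem ncard_maximal_isClique_comparabilityGraph [Finite V] [Nonempty V]
    (hforest : ∀ a : V, IsChain (· ≤ ·) (Set.Iic a)) :
    {K | Maximal (comparabilityGraph V).IsClique K}.ncard = {m : V | IsMax m}.ncard := by
  have : {K | Maximal (comparabilityGraph V).IsClique K} = Set.Iic '' {m : V | IsMax m} := by
    ext K
    simp only [Set.mem_ofPred_eq, Set.mem_image, ← maximal_isChain_iff_exists_isMax hforest,
      Maximal, isClique_comparabilityGraph_iff_isChain]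
  rw [this, Set.ncard_image_of_injective _ Set.Iic_injective]

end ComparabilityGraph

theorem triviallyPerfect_fromRel {V : Type} [Finite V] (r : V → V → Prop) [IsStrictOrder V r]
    (hforest : ∀ a b c, r a c → r b c → a = b ∨ r a b ∨ r b a) :
    triviallyPerfect.Mem (SimpleGraph.fromRel r) := by
  refine ⟨inferInstance, fun W H hW ⟨f⟩ => ?_⟩
  have : Finite W := Finite.of_injective f f.injective
  let s : W → W → Prop := fun a b => r (f a) (f b)
  have : IsStrictOrder W s :=
    { irrefl := fun a => irrefl (f a)
      trans := fun a b c => _root_.trans (a := f a) (b := f b) (c := f c) }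
  let : PartialOrder W := partialOrderOfSO s
  have hchain (c : W) : IsChain (· ≤ ·) (Set.Iic c) := by
    intro a (ha : a ≤ c) b (hb : b ≤ c) hne
    rcases ha.lt_or_eq with hac | rfl
    · rcases hb.lt_or_eq with hbc | rfl
      · exact ((hforest (f a) (f b) (f c) hac hbc).resolve_left (f.injective.ne hne)).imp
          (fun h => (show a < b from h).le) fun h => (show b < a from h).le
      · exact Or.inl ha
    · exact Or.inr hb
  have hH : H = comparabilityGraph W := by
    ext a b
    rw [← f.map_adj_iff, comparabilityGraph_adj, SimpleGraph.fromRel_adj]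
    exact and_iff_right_of_imp fun h => h.elim (ne_of_irrefl (r := r)) (ne_of_irrefl' (r := r))
  rw [hH, indepNum_comparabilityGraph hchain, ncard_maximal_isClique_comparabilityGraph hchain]

namespace BurlingTree

variable {B : BurlingTree} {l m u v w : B.T}

theorem LastBornSibling.not_le_of_siblings (hu : B.LastBornSibling u l)
    (hv : B.LastBornSibling v l) (hne : u ≠ v) : ¬ u ≤ v := fun hle =>
  hu.not_le_of_le le_rfl (hv.lt_iff.1 (hle.lt_of_ne hne)).le

variable (B) in
/-- The relation `B.CanChoose`, enlarged by an arbitrary strict linear order on the siblings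
that are not last-born. It is a strict forest order whose intersection with `C(T)` is `G(T)`. -/
def SiblingAbove (u v : B.T) : Prop :=
  B.CanChoose u v ∨ ∃ l, B.LastBornSibling u l ∧ B.LastBornSibling v l ∧ WellOrderingRel u v

theorem SiblingAbove.not_le (h : B.SiblingAbove u v) : ¬ u ≤ v := by
  obtain h | ⟨l, hu, hv, huv⟩ := h
  · exact h.not_le
  · exact hu.not_le_of_siblings hv (ne_of_irrefl huv)

theorem SiblingAbove.not_ge (h : B.SiblingAbove u v) : ¬ v ≤ u := by
  obtain h | ⟨l, hu, hv, huv⟩ := h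
  · exact h.not_ge
  · exact hv.not_le_of_siblings hu (ne_of_irrefl huv).symm

theorem CanChoose.of_sibling (h : B.CanChoose u v) (hu : B.LastBornSibling u l)
    (hw : B.LastBornSibling w l) : B.CanChoose w v :=
  let ⟨_, hu', hv⟩ := h
  ⟨l, hw, hu.unique hu' ▸ hv⟩

theorem CanChoose.sibling (h : B.CanChoose u v) (hv : B.LastBornSibling v l)
    (hw : B.LastBornSibling w l) : B.CanChoose u w :=
  let ⟨m, hu, hm⟩ := h
  ⟨m, hu, (hw.lt_iff.2 (hu.lt_of_le hv hm)).le⟩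

theorem SiblingAbove.trans (huv : B.SiblingAbove u v) (hvw : B.SiblingAbove v w) :
    B.SiblingAbove u w := by
  obtain huv | ⟨l, hu, hv, huv⟩ := huv <;> obtain hvw | ⟨m, hv', hw, hvw⟩ := hvw
  · exact Or.inl (huv.trans hvw)
  · exact Or.inl (huv.sibling hv' hw)
  · exact Or.inl (hvw.of_sibling hv hu)
  · exact Or.inr ⟨l, hu, hv.unique hv' ▸ hw, _root_.trans huv hvw⟩

theorem SiblingAbove.exists_lastBornSibling_le (h : B.SiblingAbove u w)
    (hw : B.LastBornSibling w m) : ∃ l ≤ m, B.LastBornSibling u l := by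
  obtain ⟨l, hu, hl⟩ | ⟨l, hu, hw', -⟩ := h
  · exact ⟨l, (hu.lt_of_le hw hl).le, hu⟩
  · exact ⟨l, (hw'.unique hw).le, hu⟩

theorem LastBornSibling.siblingAbove_total (hu : B.LastBornSibling u l)
    (hv : B.LastBornSibling v m) (h : l ≤ m) :
    u = v ∨ B.SiblingAbove u v ∨ B.SiblingAbove v u := by
  obtain rfl | hlt := h.eq_or_lt
  · rcases trichotomous_of WellOrderingRel u v with h | h | h
    · exact Or.inr (Or.inl (Or.inr ⟨l, hu, hv, h⟩))
    · exact Or.inl h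
    · exact Or.inr (Or.inr (Or.inr ⟨l, hv, hu, h⟩))
  · exact Or.inr (Or.inl (Or.inl ⟨l, hu, (hv.lt_iff.2 hlt).le⟩))

theorem SiblingAbove.forest (huw : B.SiblingAbove u w) (hvw : B.SiblingAbove v w) :
    u = v ∨ B.SiblingAbove u v ∨ B.SiblingAbove v u := by
  obtain ⟨k, l, m, hu, hv, hl, hm⟩ : ∃ k l m, B.LastBornSibling u l ∧ B.LastBornSibling v m ∧
      l ≤ k ∧ m ≤ k := by
    by_cases hw : ∃ k, B.LastBornSibling w k
    · obtain ⟨k, hw⟩ := hw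
      obtain ⟨l, hl, hu⟩ := huw.exists_lastBornSibling_le hw
      obtain ⟨m, hm, hv⟩ := hvw.exists_lastBornSibling_le hw
      exact ⟨k, l, m, hu, hv, hl, hm⟩
    · push Not at hw
      obtain ⟨l, hu, hl⟩ := huw.resolve_right fun ⟨k, _, hk, _⟩ => hw k hk
      obtain ⟨m, hv, hm⟩ := hvw.resolve_right fun ⟨k, _, hk, _⟩ => hw k hk
      exact ⟨w, l, m, hu, hv, hl, hm⟩
  rcases le_total_of_le hl hm with h | h
  · exact hu.siblingAbove_total hv h
  · exact (hv.siblingAbove_total hu h).imp Eq.symm Or.symm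

instance : IsStrictOrder B.T B.SiblingAbove where
  irrefl _ h := h.not_le le_rfl
  trans _ _ _ := SiblingAbove.trans

theorem derivedGraph_mem_inter :
    (triviallyPerfect.inter burlingStronglyChordal).Mem B.derivedGraph := by
  have := B.finite
  refine ⟨B.T, B.T, SimpleGraph.fromRel B.SiblingAbove, B.chordalGraph, .refl _, .refl _,
    triviallyPerfect_fromRel B.SiblingAbove fun _ _ _ => SiblingAbove.forest, ⟨B, .rfl⟩,
    fun u v => ?_⟩
  simp only [Function.Embedding.refl_apply, chordalGraph_adj, SimpleGraph.fromRel_adj]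
  constructor
  · intro h
    exact ⟨⟨h.ne, (derivedGraph_adj.1 h).imp (fun h => Or.inl (canChoose_of_mem_choose h))
      fun h => Or.inl (canChoose_of_mem_choose h)⟩, Or.inl h⟩
  · rintro ⟨⟨-, h⟩, hadj⟩
    have hincomp : ¬ u ≤ v ∧ ¬ v ≤ u :=
      h.elim (fun h => ⟨h.not_le, h.not_ge⟩) fun h => ⟨h.not_ge, h.not_le⟩
    exact hadj.resolve_right fun hcomp => hcomp.elim (hincomp.1 ·.le) (hincomp.2 ·.le)

end BurlingTree

section RootedTree

/-- The rooted tree given by a finite order with a least element in which the elements below any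
given one form a chain. -/
noncomputable def rootedTreeOfIsChainIic (α : Type*) [PartialOrder α] [OrderBot α] [Finite α]
    (h : ∀ a : α, IsChain (· ≤ ·) (Set.Iic a)) : RootedTree :=
  have exists_inf (a b : α) : ∃ m, IsGreatest (Set.Iic a ∩ Set.Iic b) m :=
    exists_isGreatest_of_isChain (Set.toFinite _) ⟨⊥, bot_le, bot_le⟩
      ((h a).mono Set.inter_subset_left)
  have exists_pred (a : α) : ∃ p ≤ a, (a ≤ p → IsMin a) ∧ ∀ x < a, x ≤ p := by
    obtain rfl | ha := eq_or_ne a ⊥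
    · exact ⟨⊥, le_rfl, fun _ => isMin_bot, fun x hx => hx.le⟩
    · obtain ⟨p, hp, hle⟩ := exists_isGreatest_of_isChain (Set.toFinite (Set.Iio a))
        ⟨⊥, ha.bot_lt⟩ ((h a).mono Set.Iio_subset_Iic_self)
      exact ⟨p, le_of_lt hp, fun hap => absurd hp hap.not_gt, fun x hx => hle hx⟩
  letI : SemilatticeInf α :=
    { (inferInstance : PartialOrder α) with
      inf a b := (exists_inf a b).choose
      inf_le_left a b := (exists_inf a b).choose_spec.1.1
      inf_le_right a b := (exists_inf a b).choose_spec.1.2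
      le_inf a b c hab hac := (exists_inf b c).choose_spec.2 ⟨hab, hac⟩ }
  letI : PredOrder α :=
    { pred a := (exists_pred a).choose
      pred_le a := (exists_pred a).choose_spec.1
      min_of_le_pred {a} := (exists_pred a).choose_spec.2.1
      le_pred_of_lt {x a} := (exists_pred a).choose_spec.2.2 x }
  ⟨α⟩

/-- The Burling tree on an order as in `rootedTreeOfIsChainIic`. The parent `p` of `v` is recovered
from the covering relation, and the root and the last-born children fall under `choose v = ∅`. -/
noncomputable def BurlingTree.ofOrder {α : Type} [PartialOrder α] [OrderBot α] [Finite α]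
    (h : ∀ a : α, IsChain (· ≤ ·) (Set.Iic a)) (lastBorn : α → α)
    (lastBorn_child : ∀ v, ¬ IsMax v → v ⋖ lastBorn v) (choose : α → Set α)
    (choose_branch : ∀ v, choose v = ∅ ∨ ∃ p b, p ⋖ v ∧ lastBorn p ≠ v ∧ lastBorn p ≤ b ∧
      choose v = Set.Icc (lastBorn p) b) : BurlingTree where
  T := rootedTreeOfIsChainIic α h
  finite := inferInstanceAs (Finite α)
  lastBorn := lastBorn
  lastBorn_child := lastBorn_child
  choose := choose
  choose_branch v _ _ := by
    obtain he | ⟨p, b, hp, -, hb⟩ := choose_branch v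
    · exact Or.inl he
    · obtain rfl := CovBy.pred_eq (α := rootedTreeOfIsChainIic α h) hp
      exact Or.inr ⟨b, hb⟩
  choose_root := (choose_branch ⊥).resolve_right fun ⟨_, _, hp, _⟩ => not_lt_bot hp.lt
  choose_lastBorn v hv := (choose_branch (lastBorn v)).resolve_right fun ⟨p, _, hp, hne, _⟩ =>
    hne <| congrArg lastBorn <| (CovBy.pred_eq (α := rootedTreeOfIsChainIic α h) hp).symm.trans
      (CovBy.pred_eq (α := rootedTreeOfIsChainIic α h) (lastBorn_child v hv))

end RootedTree

/-- Burling's step on trees. Below each leaf `s` of `base`, i.e. of a first copy of the tree, it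
hangs a further copy of the tree and a leaf `new s q` for each leaf `q`. -/
inductive Graft (α : Type*) [PartialOrder α]
  | base (a : α)
  | copy (s : {a : α // IsMax a}) (a : α)
  | new (s q : {a : α // IsMax a})

namespace Graft

section Order

variable {α : Type*} [PartialOrder α] {a b : α} {s t q : {a : α // IsMax a}}

/-- The ancestor order of the grafted tree. -/
protected inductive Le : Graft α → Graft α → Prop
  | base {a b : α} (h : a ≤ b) : Graft.Le (base a) (base b)
  | base_copy {a b : α} {s : {a : α // IsMax a}} (h : a ≤ s.1) : Graft.Le (base a) (copy s b)
  | base_new {a : α} {s q : {a : α // IsMax a}} (h : a ≤ s.1) : Graft.Le (base a) (new s q)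
  | copy {a b : α} {s : {a : α // IsMax a}} (h : a ≤ b) : Graft.Le (copy s a) (copy s b)
  | new {s q : {a : α // IsMax a}} : Graft.Le (new s q) (new s q)

instance : PartialOrder (Graft α) where
  le := Graft.Le
  le_refl
    | base _ => .base le_rfl
    | copy _ _ => .copy le_rfl
    | new _ _ => .new
  le_trans
    | _, _, _, .base h, .base h' => .base (h.trans h')
    | _, _, _, .base h, .base_copy h' => .base_copy (h.trans h')
    | _, _, _, .base h, .base_new h' => .base_new (h.trans h')
    | _, _, _, .base_copy h, .copy _ => .base_copy h
    | _, _, _, .base_new h, .new => .base_new h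
    | _, _, _, .copy h, .copy h' => .copy (h.trans h')
    | _, _, _, .new, .new => .new
  le_antisymm
    | _, _, .base h, .base h' => congrArg base (le_antisymm h h')
    | _, _, .copy h, .copy h' => congrArg (copy _) (le_antisymm h h')
    | _, _, .new, .new => rfl

@[simp]
theorem base_le_base : base a ≤ base b ↔ a ≤ b :=
  ⟨fun | .base h => h, .base⟩

@[simp]
theorem base_le_copy : base a ≤ copy s b ↔ a ≤ s :=
  ⟨fun | .base_copy h => h, .base_copy⟩

@[simp]
theorem base_le_new : base a ≤ new s q ↔ a ≤ s :=
  ⟨fun | .base_new h => h, .base_new⟩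

@[simp]
theorem copy_le_copy : copy s a ≤ copy t b ↔ s = t ∧ a ≤ b :=
  ⟨fun | .copy h => ⟨rfl, h⟩, fun | ⟨rfl, h⟩ => .copy h⟩

@[simp]
theorem not_copy_le_new : ¬ copy s a ≤ new t q :=
  nofun

@[simp]
theorem new_le_iff_eq {x : Graft α} : new s q ≤ x ↔ x = new s q :=
  ⟨fun | .new => rfl, fun h => h.ge⟩

instance [OrderBot α] : OrderBot (Graft α) where
  bot := base ⊥
  bot_le
    | base _ => .base bot_le
    | copy _ _ => .base_copy bot_le
    | new _ _ => .base_new bot_le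

instance [Finite α] : Finite (Graft α) := by
  refine Finite.of_surjective (Sum.elim base (Sum.elim (fun p : {a : α // IsMax a} × α =>
    copy p.1 p.2) fun p : {a : α // IsMax a} × {a : α // IsMax a} => new p.1 p.2)) ?_
  rintro (a | ⟨s, a⟩ | ⟨s, q⟩)
  · exact ⟨.inl a, rfl⟩
  · exact ⟨.inr (.inl (s, a)), rfl⟩
  · exact ⟨.inr (.inr (s, q)), rfl⟩

theorem isChain_Iic (h : ∀ a : α, IsChain (· ≤ ·) (Set.Iic a)) (x : Graft α) :
    IsChain (· ≤ ·) (Set.Iic x) := by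
  intro y hy z hz _
  have base_total {a b c : α} (ha : a ≤ c) (hb : b ≤ c) : base a ≤ base b ∨ base b ≤ base a :=
    ((h c).total ha hb).imp .base .base
  have copy_total (s) {a b c : α} (ha : a ≤ c) (hb : b ≤ c) :
    copy s a ≤ copy s b ∨ copy s b ≤ copy s a := ((h c).total ha hb).imp .copy .copy
  rcases hy with hy | hy | hy | hy | _ <;> rcases hz with hz | hz | hz | hz | _
  · exact base_total hy hz
  · exact base_total hy hz
  · exact Or.inl (.base_copy hy)
  · exact base_total hy hz
  · exact Or.inl (.base_new hy)
  · exact Or.inr (.base_copy hz)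
  · exact copy_total _ hy hz
  · exact Or.inr (.base_new hz)
  · exact Or.inl .new

variable (α) in
/-- The inclusion of the first copy. -/
def baseEmb : α ↪o Graft α :=
  .ofMapLEIff base fun _ _ => base_le_base

/-- The inclusion of the copy attached to the leaf `s`. -/
def copyEmb (s : {a : α // IsMax a}) : α ↪o Graft α :=
  .ofMapLEIff (copy s) fun _ _ => by simp

theorem ordConnected_range_base : (Set.range (baseEmb α)).OrdConnected :=
  IsLowerSet.ordConnected (by rintro _ _ ⟨_⟩ ⟨a, ⟨⟩⟩; exact ⟨_, rfl⟩)

theorem ordConnected_range_copy (s : {a : α // IsMax a}) :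
    (Set.range (copyEmb s)).OrdConnected :=
  IsUpperSet.ordConnected (by rintro _ _ ⟨_⟩ ⟨a, ⟨⟩⟩; exact ⟨_, rfl⟩)

theorem isMax_copy (ha : IsMax a) : IsMax (copy s a) := by
  rintro _ ⟨h⟩
  exact .copy (ha ‹_›)

theorem isMax_new : IsMax (new s q) := by
  rintro _ ⟨⟩
  exact .new

theorem base_covBy_copy_bot [OrderBot α] (s : {a : α // IsMax a}) : base s.1 ⋖ copy s ⊥ := by
  refine ⟨lt_of_le_not_ge (.base_copy le_rfl) nofun, fun x hsx hx => ?_⟩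
  cases hx.le with
  | base_copy h => exact hsx.not_ge (.base h)
  | copy => exact hx.not_ge (.copy bot_le)

theorem base_covBy_new (s q : {a : α // IsMax a}) : base s.1 ⋖ new s q := by
  refine ⟨lt_of_le_not_ge (.base_new le_rfl) nofun, fun x hsx hx => ?_⟩
  cases hx.le with
  | base_new h => exact hsx.not_ge (.base h)
  | new => exact hx.false

end Order

end Graft

namespace BurlingTree

section Graft

variable (B : BurlingTree)

open Classical in
/-- The last-born child of each vertex of `B.graft`. -/
noncomputable def graftLastBorn : Graft B.T → Graft B.T
  | .base a => if h : IsMax a then .copy ⟨a, h⟩ ⊥ else .base (B.lastBorn a)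
  | .copy s a => .copy s (B.lastBorn a)
  | .new s q => .new s q

/-- The set chosen by each vertex of `B.graft`. The new leaf indexed by `s` and `q` chooses the
whole branch of `q` in the copy attached to `s`. -/
def graftChoose : Graft B.T → Set (Graft B.T)
  | .base a => .base '' B.choose a
  | .copy s a => .copy s '' B.choose a
  | .new s q => .copy s '' Set.Iic q.1

theorem graftLastBorn_of_isMax (s : {a : B.T // IsMax a}) :
    B.graftLastBorn (.base s) = .copy s ⊥ :=
  dif_pos s.2

theorem covBy_graftLastBorn (x : Graft B.T) (hx : ¬ IsMax x) : x ⋖ B.graftLastBorn x := by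
  obtain a | ⟨s, a⟩ | ⟨s, q⟩ := x
  · by_cases ha : IsMax a
    · exact B.graftLastBorn_of_isMax ⟨a, ha⟩ ▸ Graft.base_covBy_copy_bot ⟨a, ha⟩
    · rw [graftLastBorn, dif_neg ha]
      exact (B.lastBorn_child a ha).image (Graft.baseEmb B.T) Graft.ordConnected_range_base
  · have ha : ¬ IsMax a := fun ha => hx (Graft.isMax_copy ha)
    exact (B.lastBorn_child a ha).image (Graft.copyEmb s) (Graft.ordConnected_range_copy s)
  · exact (hx Graft.isMax_new).elim

theorem image_choose_eq_empty_or_Icc {β : Type*} [PartialOrder β] (f : B.T ↪o β)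
    (hf : (Set.range f).OrdConnected) {lastBorn : β → β}
    (hlastBorn : ∀ a, ¬ IsMax a → lastBorn (f a) = f (B.lastBorn a)) (v : B.T) :
    f '' B.choose v = ∅ ∨ ∃ p b, p ⋖ f v ∧ lastBorn p ≠ f v ∧ lastBorn p ≤ b ∧
      f '' B.choose v = Set.Icc (lastBorn p) b := by
  obtain he | ⟨_, b, ⟨hne, p, hp, rfl⟩, hb, he⟩ := B.choose_eq_empty_or_Icc v
  · simp [he]
  · have hl := hlastBorn p hp.lt.not_isMax
    refine Or.inr ⟨f p, f b, hp.image f hf, hl ▸ f.injective.ne hne, hl ▸ f.monotone hb, ?_⟩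
    rw [he, hl, f.image_Icc hf]

theorem graftChoose_eq_empty_or_Icc (x : Graft B.T) :
    B.graftChoose x = ∅ ∨ ∃ p b, p ⋖ x ∧ B.graftLastBorn p ≠ x ∧ B.graftLastBorn p ≤ b ∧
      B.graftChoose x = Set.Icc (B.graftLastBorn p) b := by
  obtain a | ⟨s, a⟩ | ⟨s, q⟩ := x
  · exact B.image_choose_eq_empty_or_Icc (Graft.baseEmb B.T) Graft.ordConnected_range_base
      (fun _ h => dif_neg h) a
  · exact B.image_choose_eq_empty_or_Icc (Graft.copyEmb s) (Graft.ordConnected_range_copy s)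
      (fun _ _ => rfl) a
  · refine Or.inr ⟨.base s.1, .copy s q.1, Graft.base_covBy_new s q, ?_⟩
    rw [graftLastBorn_of_isMax]
    refine ⟨nofun, .copy bot_le, ?_⟩
    rw [graftChoose, ← Set.Icc_bot]
    exact (Graft.copyEmb s).image_Icc (Graft.ordConnected_range_copy s) ⊥ q.1

/-- Burling's step: the tree `Graft B.T` in which each new leaf indexed by `s` and `q` chooses the
branch of `q` in the copy of `B` attached to `s`. -/
noncomputable def graft : BurlingTree :=
  have := B.finite
  ofOrder (Graft.isChain_Iic fun _ _ hx _ hy _ => le_total_of_le hx hy) B.graftLastBorn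
    B.covBy_graftLastBorn B.graftChoose B.graftChoose_eq_empty_or_Icc

end Graft

end BurlingTree

/-- A realization of a graph with sets inside the derived graph of a Burling tree in which each set
is cut out by the branch of a leaf. -/
structure TreeRepresentation (X : GraphWithSets) where
  tree : BurlingTree
  graphEmb : X.graph ↪g tree.derivedGraph
  leafEmb : X.I ↪ {v : tree.T // IsMax v}
  mem_sets_iff : ∀ s v, v ∈ X.sets s ↔ graphEmb v ≤ (leafEmb s).1

namespace TreeRepresentation

variable {X : GraphWithSets} (R : TreeRepresentation X)

/-- The vertices of the next graph inside the grafted tree. -/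
def nextVertex : X.NextV → Graft R.tree.T
  | .inl a => .base (R.graphEmb a)
  | .inr (.inl (s, a)) => .copy (R.leafEmb s) (R.graphEmb a)
  | .inr (.inr (s, q)) => .new (R.leafEmb s) (R.leafEmb q)

theorem nextVertex_injective : Function.Injective R.nextVertex := by
  rintro (a | ⟨s, a⟩ | ⟨s, q⟩) (b | ⟨t, b⟩ | ⟨t, p⟩) h <;>
    simp_all [nextVertex]

theorem nextAdj_iff (u v : X.NextV) : X.nextAdj u v ↔
    R.nextVertex v ∈ R.tree.graftChoose (R.nextVertex u) ∨
      R.nextVertex u ∈ R.tree.graftChoose (R.nextVertex v) := by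
  rcases u with a | ⟨s, a⟩ | ⟨s, q⟩ <;> rcases v with b | ⟨t, b⟩ | ⟨t, p⟩ <;>
    simp [nextVertex, GraphWithSets.nextAdj, BurlingTree.graftChoose, R.mem_sets_iff,
      ← R.graphEmb.map_adj_iff, BurlingTree.derivedGraph_adj,
      and_comm, and_or_left, eq_comm]

/-- The leaves of the grafted tree whose branches cut out the next sets. -/
def nextLeaf : (X.I × X.I) ⊕ (X.I × X.I) → {x : Graft R.tree.T // IsMax x}
  | .inl (s, q) => ⟨.copy (R.leafEmb s) (R.leafEmb q), Graft.isMax_copy (R.leafEmb q).2⟩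
  | .inr (s, q) => ⟨.new (R.leafEmb s) (R.leafEmb q), Graft.isMax_new⟩

theorem nextLeaf_injective : Function.Injective R.nextLeaf := by
  rintro (⟨s, q⟩ | ⟨s, q⟩) (⟨t, p⟩ | ⟨t, p⟩) h <;>
    simp_all [nextLeaf, ← Subtype.ext_iff]

theorem mem_next_sets_iff (i : (X.I × X.I) ⊕ (X.I × X.I)) (v : X.NextV) :
    v ∈ X.next.sets i ↔ R.nextVertex v ≤ (R.nextLeaf i).1 := by
  rcases i with ⟨s, q⟩ | ⟨s, q⟩
  · change v ∈ (Sum.inl '' X.sets s ∪ (fun b => Sum.inr (Sum.inl (s, b))) '' X.sets q : Set X.NextV)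
      ↔ _
    rcases v with a | ⟨t, a⟩ | ⟨t, p⟩ <;>
      simp [nextVertex, nextLeaf, R.mem_sets_iff, and_comm, eq_comm]
  · change v ∈ (Sum.inl '' X.sets s ∪ {Sum.inr (Sum.inr (s, q))} : Set X.NextV) ↔ _
    rcases v with a | ⟨t, a⟩ | ⟨t, p⟩ <;>
      simp [nextVertex, nextLeaf, R.mem_sets_iff, and_comm, eq_comm]

/-- The representation of the next graph with sets in the grafted tree. -/
noncomputable def next : TreeRepresentation X.next where
  tree := R.tree.graft
  graphEmb :=
    { toFun := R.nextVertex
      inj' := R.nextVertex_injective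
      map_rel_iff' := fun {u v} =>
        BurlingTree.derivedGraph_adj.trans (R.nextAdj_iff u v).symm }
  leafEmb := ⟨R.nextLeaf, R.nextLeaf_injective⟩
  mem_sets_iff := R.mem_next_sets_iff

end TreeRepresentation

theorem nonempty_treeRepresentation_burlingSystem (n : ℕ) :
    Nonempty (TreeRepresentation (burlingSystem n)) := by
  induction n with
  | zero =>
    let B : BurlingTree := .ofOrder (α := Unit)
      (fun _ => Set.subsingleton_of_subsingleton.isChain) id
      (fun v hv => (hv isMax_top).elim) (fun _ => ∅) fun _ => Or.inl rfl
    exact ⟨{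
      tree := B
      graphEmb :=
        { toFun := id
          inj' := Function.injective_id
          map_rel_iff' := BurlingTree.derivedGraph_adj.trans (or_self_iff.trans Iff.rfl) }
      leafEmb := ⟨fun v => ⟨v, isMax_top (α := Unit)⟩, fun _ _ _ => rfl⟩
      mem_sets_iff := fun _ _ => ⟨fun _ => le_rfl, fun _ => Set.mem_univ _⟩ }⟩
  | succ n ih => exact ih.map TreeRepresentation.next

theorem exists_isIndContained_derivedGraph_of_mem_burlingGraphs {V : Type} {G : SimpleGraph V}
    (hG : burlingGraphs.Mem G) : ∃ B : BurlingTree, G ⊴ B.derivedGraph :=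
  let ⟨n, hn⟩ := hG
  let ⟨R⟩ := nonempty_treeRepresentation_burlingSystem n
  ⟨R.tree, hn.trans ⟨R.graphEmb⟩⟩

theorem mem_inter_of_mem_burlingGraphs {V : Type} {G : SimpleGraph V} (hG : burlingGraphs.Mem G) :
    (triviallyPerfect.inter burlingStronglyChordal).Mem G :=
  let ⟨_, hB⟩ := exists_isIndContained_derivedGraph_of_mem_burlingGraphs hG
  (triviallyPerfect.inter burlingStronglyChordal).hereditary hB BurlingTree.derivedGraph_mem_inter

theorem cliqueFree_of_mem_burlingGraphs {V : Type} {G : SimpleGraph V}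
    (hG : burlingGraphs.Mem G) : G.CliqueFree 3 :=
  let ⟨_, ⟨f⟩⟩ := exists_isIndContained_derivedGraph_of_mem_burlingGraphs hG
  BurlingTree.derivedGraph_cliqueFree.comap f.toCopy.isContained

section ManyColors

namespace GraphWithSets

variable {X : GraphWithSets}

variable (X) in
/-- The inclusion of the first copy into the next graph. -/
def baseHom : X.graph →g X.next.graph where
  toFun := Sum.inl
  map_rel' h := h

/-- The inclusion of the copy with index `s` into the next graph. -/
def copyHom (s : X.I) : X.graph →g X.next.graph where
  toFun a := Sum.inr (Sum.inl (s, a))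
  map_rel' h := ⟨rfl, h⟩

/-- The vertex `v_{s,q}` of the next graph. -/
def newVertex (s q : X.I) : X.next.V :=
  Sum.inr (Sum.inr (s, q))

theorem image_next_sets_inl {β : Type*} (f : X.next.V → β) (s q : X.I) :
    f '' X.next.sets (.inl (s, q)) = f ∘ X.baseHom '' X.sets s ∪ f ∘ copyHom s '' X.sets q :=
  calc f '' X.next.sets (.inl (s, q))
    _ = f '' (X.baseHom '' X.sets s ∪ copyHom s '' X.sets q) := rfl
    _ = f ∘ X.baseHom '' X.sets s ∪ f ∘ copyHom s '' X.sets q := by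
      rw [Set.image_union, Set.image_comp, Set.image_comp]

theorem image_next_sets_inr {β : Type*} (f : X.next.V → β) (s q : X.I) :
    f '' X.next.sets (.inr (s, q)) =
      insert (f (newVertex s q)) (f ∘ X.baseHom '' X.sets s) :=
  calc f '' X.next.sets (.inr (s, q))
    _ = f '' (X.baseHom '' X.sets s ∪ {newVertex s q}) := rfl
    _ = insert (f (newVertex s q)) (f ∘ X.baseHom '' X.sets s) := by
      rw [Set.image_union, Set.image_singleton, Set.union_singleton, Set.image_comp]

theorem coloring_next_notMem_image {α : Type*} (C : X.next.graph.Coloring α) (s q : X.I) :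
    C (newVertex s q) ∉ C ∘ copyHom s '' X.sets q := by
  rintro ⟨b, hb, he⟩
  exact C.valid (show X.next.graph.Adj (copyHom s b) (newVertex s q) from ⟨rfl, hb⟩) he

theorem exists_succ_le_encard_image_next {α : Type*} {k : ℕ}
    (hX : ∀ C : X.graph.Coloring α, ∃ s, k ≤ (C '' X.sets s).encard)
    (C : X.next.graph.Coloring α) : ∃ i, (k + 1 : ℕ) ≤ (C '' X.next.sets i).encard := by
  obtain ⟨s, hs⟩ := hX (C.comp X.baseHom)
  obtain ⟨q, hq⟩ := hX (C.comp (copyHom s))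
  by_cases hmem : C (newVertex s q) ∈ C ∘ X.baseHom '' X.sets s
  · refine ⟨.inl (s, q), ?_⟩
    calc ((k + 1 : ℕ) : ℕ∞) ≤ (C ∘ copyHom s '' X.sets q).encard + 1 := by
          exact_mod_cast add_le_add_left hq 1
      _ = (insert (C (newVertex s q)) (C ∘ copyHom s '' X.sets q)).encard :=
          (Set.encard_insert_of_notMem (coloring_next_notMem_image C s q)).symm
      _ ≤ (C '' X.next.sets (.inl (s, q))).encard := by
          rw [image_next_sets_inl]
          exact Set.encard_le_encard (Set.insert_subset (.inl hmem) Set.subset_union_right)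
  · refine ⟨.inr (s, q), ?_⟩
    rw [image_next_sets_inr, Set.encard_insert_of_notMem hmem]
    exact_mod_cast add_le_add_left hs 1

end GraphWithSets

theorem exists_succ_le_encard_image_burlingSystem {α : Type*} (n : ℕ)
    (C : (burlingSystem n).graph.Coloring α) :
    ∃ s, (n + 1 : ℕ) ≤ (C '' (burlingSystem n).sets s).encard := by
  induction n with
  | zero =>
    refine ⟨(), ?_⟩
    rw [Nat.zero_add, Nat.cast_one, Set.one_le_encard_iff_nonempty]
    exact Set.Nonempty.image C ⟨(), Set.mem_univ _⟩
  | succ n ih => exact GraphWithSets.exists_succ_le_encard_image_next ih C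

theorem le_chromaticNumber_burlingGraph (n : ℕ) :
    ((n + 1 : ℕ) : ℕ∞) ≤ (burlingGraph n).chromaticNumber := by
  refine SimpleGraph.le_chromaticNumber_iff_colorable.2 fun m ⟨C⟩ => ?_
  obtain ⟨s, hs⟩ := exists_succ_le_encard_image_burlingSystem n C
  exact Nat.cast_le.1 (hs.trans (Set.encard_le_card.trans_eq (by simp)))

end ManyColors

theorem not_intersectionwiseChiGuarding_triviallyPerfect :
    ¬ triviallyPerfect.IntersectionwiseChiGuarding := by
  intro h
  obtain ⟨f, hf, hbound⟩ := h _ burlingStronglyChordal_chiBounded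
  have hG : burlingGraphs.Mem (burlingGraph (f 2)) := ⟨f 2, .rfl⟩
  have hclique : (burlingGraph (f 2)).cliqueNum ≤ 2 := by
    obtain ⟨s, hs⟩ := (burlingGraph (f 2)).exists_isNClique_cliqueNum
    by_contra! hlt
    exact (cliqueFree_of_mem_burlingGraphs hG).mono hlt s hs
  have hchi : ((f 2 + 1 : ℕ) : ℕ∞) ≤ f 2 :=
    calc ((f 2 + 1 : ℕ) : ℕ∞) ≤ (burlingGraph (f 2)).chromaticNumber :=
          le_chromaticNumber_burlingGraph (f 2)
      _ ≤ f (burlingGraph (f 2)).cliqueNum := hbound _ _ (mem_inter_of_mem_burlingGraphs hG)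
      _ ≤ f 2 := by exact_mod_cast hf hclique
  exact Nat.not_succ_le_self _ (Nat.cast_le.1 hchi)

theorem mainTheorem6 :
    ¬ triviallyPerfect.IntersectionwiseChiGuarding ∧
    burlingStronglyChordal.ChiBounded ∧
    (∀ (V : Type) (G : SimpleGraph V), burlingStronglyChordal.Mem G → IsStronglyChordal G) ∧
    (∀ (V : Type) (G : SimpleGraph V),
      burlingGraphs.Mem G → (triviallyPerfect.inter burlingStronglyChordal).Mem G) ∧
    (∀ (V : Type) (G : SimpleGraph V), burlingGraphs.Mem G → G.CliqueFree 3) ∧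
    (∀ n : ℕ, ((n + 1 : ℕ) : ℕ∞) ≤ (burlingGraph n).chromaticNumber) :=
  ⟨not_intersectionwiseChiGuarding_triviallyPerfect, burlingStronglyChordal_chiBounded,
    fun _ _ hG => (hasSimpleVertices_of_mem_burlingStronglyChordal hG).isStronglyChordal,
    fun _ _ => mem_inter_of_mem_burlingGraphs, fun _ _ => cliqueFree_of_mem_burlingGraphs,
    le_chromaticNumber_burlingGraph⟩
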